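/- All inverse semigroups have a zero $0$; $s^*$ denotes the unique element with $ss^*s=s$ and $s^*ss^*=s^*$. Let $S$ be an inverse semigroup and let $E=E(S)$ be its semilattice of idempotents, with $e\wedge f=ef$. A representation of $S$ on a Hilbert space $H$ is a map $\pi:S\to B(H)$ with $\pi(st)=\pi(s)\pi(t)$, $\pi(s^*)=\pi(s)^*$ and $\pi(0)=0$. The operators $\pi(e)$, $e\in E$, are commuting projections, regarded as elements of a Boolean algebra of projections in $B(H)$, with $p\wedge q=pq$, $p\vee q=p+q-pq$, $\neg p=1-p$ and with the identity operator of $H$ as its unit. For finite sets $X,Y\subseteq E$ let $E^{X,Y}=\{z\in E: z\le x\ \forall x\in X,\ z\wedge y=0\ \forall y\in Y\}$. A cover for a set $F\subseteq E$ is a subset $Z\subseteq F$ such that for every nonzero $x\in F$ there is $z\in Z$ with $z\wedge x\ne 0$. The representation $\pi$ is tight if $$\bigvee_{z\in Z}\pi(z)=\bigwedge_{x\in X}\pi(x)\wedge\bigwedge_{y\in Y}\neg\pi(y)$$ for all finite $X,Y\subseteq E$ and every finite cover $Z$ for $E^{X,Y}$ (an empty join is $0$, an empty meet is $1$). It is cover-to-join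 if $\bigvee_{z\in Z}\pi(z)=\pi(x)$ for all $x\in E$ and every finite cover $Z$ for $\{z\in E: z\le x\}$. For a class $\mathcal R$ of Hilbert space representations of $S$, a C*-algebra $A$ (not necessarily unital) with a map $\iota:S\to A$ is universal for $\mathcal R$ if $\iota(S)$ generates $A$ as a C*-algebra, if for every $\pi\in\mathcal R$ on a Hilbert space $H$ there is a unique *-homomorphism $\varphi_\pi:A\to B(H)$ with $\varphi_\pi\circ\iota=\pi$, and if the $\varphi_\pi$, $\pi\in\mathcal R$, separate the elements of $A$. **Theorem 6.1.** For every inverse semigroup $S$, there exist a universal C*-algebra $C^*_{\mathrm{tight}}(S)$ for the tight Hilbert space representations of $S$ and a universal C*-algebra $C^*_{\text{cover-to-join}}(S)$ for the cover-to-join Hilbert space representations of $S$ (in each case, the C*-algebra generated by the direct sum of all representations in the class), and any two such algebras are isomorphic, $$C^*_{\mathrm{tight}}(S)\simeq C^*_{\text{cover-to-join}}(S),$$ by a *-isomorphism that carries the canonical image of each $s\in S$ in the first to its canonical image in the second. -/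

import Mathlib

open scoped ENNReal

universe u

/-! ### Inverse semigroups with zero and their idempotent semilattices -/

/-- An inverse semigroup with zero: every `s` has a unique generalized inverse, written `star s`. -/
class InverseSemigroupWithZero (S : Type*) extends SemigroupWithZero S, Star S where
  mul_star_mul_self (s : S) : s * star s * s = s
  star_mul_self_mul_star (s : S) : star s * s * star s = star s
  eq_star (s t : S) : s * t * s = s → t * s * t = t → t = star s

namespace InverseSemigroupWithZero

variable {S : Type*} [InverseSemigroupWithZero S]

theorem star_eq_self {e : S} (he : e * e = e) : star e = e :=
  (eq_star e e (by rw [he, he]) (by rw [he, he])).symm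

theorem eq_of_inverses {s t r : S} (h1 : s * t * s = s) (h2 : t * s * t = t)
    (h3 : s * r * s = s) (h4 : r * s * r = r) : t = r :=
  (eq_star s t h1 h2).trans (eq_star s r h3 h4).symm

theorem idem_mul {e f : S} (he : e * e = e) (hf : f * f = f) : e * f * (e * f) = e * f := by
  have h1 : e * f * star (e * f) * (e * f) = e * f := mul_star_mul_self (e * f)
  have h2 : star (e * f) * (e * f) * star (e * f) = star (e * f) := star_mul_self_mul_star (e * f)
  generalize star (e * f) = x at h1 h2
  have he' : ∀ a, e * (e * a) = e * a := fun a => by rw [← mul_assoc, he]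
  have hf' : ∀ a, f * (f * a) = f * a := fun a => by rw [← mul_assoc, hf]
  simp only [mul_assoc] at h1 h2
  have hx : ∀ a, x * (e * (f * (x * a))) = x * a := fun a => by
    have := congrArg (· * a) h2
    simpa only [mul_assoc] using this
  have hy : f * (x * e) = x := by
    refine eq_of_inverses (s := e * f) ?_ ?_ ?_ ?_
    · simp only [mul_assoc, he', hf', h1]
    · simp only [mul_assoc, he', hf', hx]
    · simpa only [mul_assoc] using h1
    · simpa only [mul_assoc] using h2
  have hxx : x * x = x := by
    have : f * (x * e) * (f * (x * e)) = f * (x * e) := by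
      simp only [mul_assoc, hx]
    rwa [hy] at this
  have : e * f = x := by
    refine eq_of_inverses (s := x) ?_ ?_ ?_ ?_
    · simpa only [mul_assoc] using h2
    · simpa only [mul_assoc] using h1
    · rw [hxx, hxx]
    · rw [hxx, hxx]
  rw [this, hxx]

theorem idem_comm {e f : S} (he : e * e = e) (hf : f * f = f) : e * f = f * e := by
  have h1 := idem_mul he hf
  have h2 := idem_mul hf he
  have he' : ∀ a, e * (e * a) = e * a := fun a => by rw [← mul_assoc, he]
  have hf' : ∀ a, f * (f * a) = f * a := fun a => by rw [← mul_assoc, hf]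
  refine eq_of_inverses (s := e * f) ?_ ?_ ?_ ?_
  · rw [h1, h1]
  · rw [h1, h1]
  · simp only [mul_assoc, he', hf'] at h1 ⊢
    exact h1
  · simp only [mul_assoc, he', hf'] at h2 ⊢
    exact h2

end InverseSemigroupWithZero

open InverseSemigroupWithZero

/-- The set `E(S)` of idempotents of `S`. -/
def IdempotentSemilattice (S : Type*) [InverseSemigroupWithZero S] : Type _ :=
  {e : S // e * e = e}

/-- `E(S)` is a semilattice: `e ⊓ f = e * f`, and `e ≤ f` means `e * f = e`. -/
instance (S : Type*) [InverseSemigroupWithZero S] : SemilatticeInf (IdempotentSemilattice S) where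
  le e f := e.1 * f.1 = e.1
  le_refl e := e.2
  le_trans e f g hef hfg := show e.1 * g.1 = e.1 by rw [← hef, mul_assoc, hfg]
  le_antisymm e f hef hfe := Subtype.ext (by rw [← hef, idem_comm e.2 f.2, hfe])
  inf e f := ⟨e.1 * f.1, idem_mul e.2 f.2⟩
  inf_le_left e f := show e.1 * f.1 * e.1 = e.1 * f.1 by
    rw [idem_comm e.2 f.2, mul_assoc, e.2]
  inf_le_right e f := show e.1 * f.1 * f.1 = e.1 * f.1 by rw [mul_assoc, f.2]
  le_inf e f g hef heg := show e.1 * (f.1 * g.1) = e.1 by rw [← mul_assoc, hef, heg]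

/-- The least element of `E(S)` is the zero of `S`. -/
instance (S : Type*) [InverseSemigroupWithZero S] : OrderBot (IdempotentSemilattice S) where
  bot := ⟨0, zero_mul 0⟩
  bot_le e := zero_mul e.1

/-! ### Tight and cover-to-join representations of semilattices -/

section Semilattice

variable {E : Type*} [SemilatticeInf E] [OrderBot E]

/-- `Z` is a cover for `F`: a subset of `F` such that every nonzero element of `F` meets
some element of `Z`. -/
def IsCover (Z F : Set E) : Prop :=
  Z ⊆ F ∧ ∀ x ∈ F, x ≠ ⊥ → ∃ z ∈ Z, z ⊓ x ≠ ⊥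

/-- The set `E^{X,Y}` of the elements below every `x ∈ X` and orthogonal to every `y ∈ Y`. -/
def meetSet (X Y : Finset E) : Set E :=
  {z | (∀ x ∈ X, z ≤ x) ∧ ∀ y ∈ Y, z ⊓ y = ⊥}

/-- A representation of the semilattice `E` in a generalized Boolean algebra `B`. -/
structure SemilatticeRep (E : Type*) [SemilatticeInf E] [OrderBot E]
    (B : Type*) [GeneralizedBooleanAlgebra B] where
  toFun : E → B
  map_bot : toFun ⊥ = ⊥
  map_inf (x y : E) : toFun (x ⊓ y) = toFun x ⊓ toFun y

/-- Tightness of a representation in a Boolean algebra: for all finite `X`, `Y` and every finite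
cover `Z` for `E^{X,Y}`, the join of `π z`, `z ∈ Z`, is the meet of all `π x` and all `(π y)ᶜ`
(the empty join is `⊥` and the empty meet is `⊤`). -/
def SemilatticeRep.IsTight {B : Type*} [BooleanAlgebra B] (π : SemilatticeRep E B) : Prop :=
  ∀ X Y Z : Finset E, IsCover (Z : Set E) (meetSet X Y) →
    Z.sup π.toFun = X.inf π.toFun ⊓ Y.inf (fun y => (π.toFun y)ᶜ)

/-- A representation in a generalized Boolean algebra is cover-to-join if `π x` is the join of
`π z`, `z ∈ Z`, whenever `Z` is a finite cover for `E^{{x},∅} = {z | z ≤ x}`. -/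
def SemilatticeRep.IsCoverToJoin {B : Type*} [GeneralizedBooleanAlgebra B]
    (π : SemilatticeRep E B) : Prop :=
  ∀ (x : E) (Z : Finset E), IsCover (Z : Set E) (meetSet {x} ∅) → Z.sup π.toFun = π.toFun x

end Semilattice

/-! ### Hilbert space representations of inverse semigroups -/

/-- A representation of the inverse semigroup `S` on the Hilbert space `H`. -/
structure HilbertRep (S : Type*) [InverseSemigroupWithZero S]
    (H : Type*) [NormedAddCommGroup H] [InnerProductSpace ℂ H] [CompleteSpace H] where
  toFun : S → H →L[ℂ] H
  map_mul (s t : S) : toFun (s * t) = toFun s * toFun t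
  map_star (s : S) : toFun (star s) = star (toFun s)
  map_zero : toFun 0 = 0

namespace HilbertRep

variable {S : Type*} [InverseSemigroupWithZero S]
  {H : Type*} [NormedAddCommGroup H] [InnerProductSpace ℂ H] [CompleteSpace H]

/-- The unital *-algebra of operators generated by `π(E(S))`. It is commutative and contains the
identity of `H`, so that its idempotents are orthogonal projections and form a Boolean algebra
under `p ⊓ q = p * q`, `p ⊔ q = p + q - p * q`, `pᶜ = 1 - p`, with top element the identity
operator of `H`. -/
noncomputable def diagonal (π : HilbertRep S H) : StarSubalgebra ℂ (H →L[ℂ] H) :=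
  StarAlgebra.adjoin ℂ (Set.range fun e : IdempotentSemilattice S => π.toFun e.1)

instance (π : HilbertRep S H) : IsMulCommutative π.diagonal := by
  have key : ∀ e f : IdempotentSemilattice S,
      π.toFun e.1 * π.toFun f.1 = π.toFun f.1 * π.toFun e.1 := fun e f => by
    rw [← π.map_mul, ← π.map_mul, idem_comm e.2 f.2]
  refine StarAlgebra.isMulCommutative_adjoin ℂ ?_ ?_
  · rintro _ ⟨e, rfl⟩ _ ⟨f, rfl⟩
    exact key e f
  · rintro _ ⟨e, rfl⟩ _ ⟨f, rfl⟩
    simp only [← π.map_star, star_eq_self f.2]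
    exact key e f

section

open scoped IsMulCommutative

/-- The commutative ring structure on `π.diagonal`. -/
noncomputable instance (π : HilbertRep S H) : CommRing π.diagonal := inferInstance

end

/-- The Boolean algebra of the projections in `π.diagonal`. -/
abbrev Projections (π : HilbertRep S H) : Type _ := {p : π.diagonal // IsIdempotentElem p}

/-- The restriction of `π` to `E(S)`, as a representation in a Boolean algebra of projections. -/
noncomputable def restrict (π : HilbertRep S H) :
    SemilatticeRep (IdempotentSemilattice S) π.Projections where
  toFun e := ⟨⟨π.toFun e.1, StarAlgebra.subset_adjoin ℂ _ ⟨e, rfl⟩⟩, Subtype.ext (by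
    change π.toFun e.1 * π.toFun e.1 = π.toFun e.1
    rw [← π.map_mul, e.2])⟩
  map_bot := Subtype.ext (Subtype.ext π.map_zero)
  map_inf e f := Subtype.ext (Subtype.ext (π.map_mul e.1 f.1))

/-- `π` is tight if its restriction to `E(S)` is. -/
def IsTight (π : HilbertRep S H) : Prop := π.restrict.IsTight

/-- `π` is cover-to-join if its restriction to `E(S)` is. -/
def IsCoverToJoin (π : HilbertRep S H) : Prop := π.restrict.IsCoverToJoin

theorem norm_le_one (π : HilbertRep S H) (s : S) : ‖π.toFun s‖ ≤ 1 := by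
  have hp : star s * s * (star s * s) = star s * s := by
    rw [← mul_assoc, star_mul_self_mul_star]
  have h1 : ‖π.toFun (star s * s)‖ = ‖π.toFun s‖ * ‖π.toFun s‖ := by
    rw [π.map_mul, π.map_star, CStarRing.norm_star_mul_self]
  have h2 : ‖π.toFun (star s * s)‖ = ‖π.toFun (star s * s)‖ * ‖π.toFun (star s * s)‖ := by
    rw [← CStarRing.norm_star_mul_self, ← π.map_star, star_eq_self hp, ← π.map_mul, hp]
  rw [h1] at h2
  by_contra! h
  have h3 : 1 < ‖π.toFun s‖ * ‖π.toFun s‖ := by nlinarith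
  nlinarith

end HilbertRep

/-! ### Universal C*-algebras for classes of Hilbert space representations -/

/-- A class of Hilbert space representations of `S`. -/
def RepClass (S : Type u) [InverseSemigroupWithZero S] : Type (u + 1) :=
  ∀ (H : Type u) [NormedAddCommGroup H] [InnerProductSpace ℂ H] [CompleteSpace H],
    HilbertRep S H → Prop

/-- The class of all tight Hilbert space representations of `S`. -/
def tightReps (S : Type u) [InverseSemigroupWithZero S] : RepClass S :=
  fun _ _ _ _ π => π.IsTight

/-- The class of all cover-to-join Hilbert space representations of `S`. -/
def coverToJoinReps (S : Type u) [InverseSemigroupWithZero S] : RepClass S :=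
  fun _ _ _ _ π => π.IsCoverToJoin

/-- The C*-algebra `A` with the map `ι : S → A` is universal for the class `R`: `A` is generated
as a C*-algebra by `ι(S)`, every representation in `R` factors uniquely through `ι` by a
*-homomorphism, and the *-homomorphisms so obtained separate the elements of `A` (so that the norm
of `A` is the supremum of the operator seminorms given by the representations in `R`). -/
structure IsUniversalCStarAlgebra {S : Type u} [InverseSemigroupWithZero S] (R : RepClass S)
    (A : Type*) [NonUnitalCStarAlgebra A] (ι : S → A) : Prop where
  generates : (NonUnitalStarAlgebra.adjoin ℂ (Set.range ι)).topologicalClosure = ⊤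
  existsUnique_hom : ∀ (H : Type u) [NormedAddCommGroup H] [InnerProductSpace ℂ H]
    [CompleteSpace H] (π : HilbertRep S H), R H π →
      ∃! φ : A →⋆ₙₐ[ℂ] (H →L[ℂ] H), ∀ s, φ (ι s) = π.toFun s
  separates : ∀ a : A, a ≠ 0 →
    ∃ (H : Type u) (_ : NormedAddCommGroup H) (_ : InnerProductSpace ℂ H) (_ : CompleteSpace H)
      (π : HilbertRep S H) (φ : A →⋆ₙₐ[ℂ] (H →L[ℂ] H)),
      R H π ∧ (∀ s, φ (ι s) = π.toFun s) ∧ φ a ≠ 0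

section Universal

variable {S : Type u} [InverseSemigroupWithZero S]

/-- The representations in the class `R`, as a type. -/
structure RepOf (R : RepClass S) where
  space : Type u
  [normed : NormedAddCommGroup space]
  [inner : InnerProductSpace ℂ space]
  [complete : CompleteSpace space]
  rep : HilbertRep S space
  mem : R space rep

attribute [instance] RepOf.normed RepOf.inner RepOf.complete

/-- The C*-algebra of the bounded families of operators, one on the space of each representation
in `R`, with the supremum norm. -/
def RepOf.Product (R : RepClass S) : Type (u + 1) :=
  lp (fun r : RepOf R => r.space →L[ℂ] r.space) ∞

noncomputable instance (R : RepClass S) : NonUnitalCStarAlgebra (RepOf.Product R) :=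
  inferInstanceAs (NonUnitalCStarAlgebra (lp (fun r : RepOf R => r.space →L[ℂ] r.space) ∞))

/-- The direct sum of all representations in `R`. -/
noncomputable def RepOf.directSum (R : RepClass S) (s : S) : RepOf.Product R :=
  ⟨fun r => r.rep.toFun s, memℓp_infty_iff.2
    ⟨1, by rintro _ ⟨r, rfl⟩; exact r.rep.norm_le_one s⟩⟩

/-- The universal C*-algebra of the class `R`: the C*-algebra generated by the direct sum of all
representations in `R`, in other words the separated completion of the free *-algebra on `S` for
the seminorm `a ↦ ⨆ ‖π(a)‖`, where `π` runs over `R`. -/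
def UniversalCStarAlgebra (R : RepClass S) : Type (u + 1) :=
  ↥(NonUnitalStarSubalgebra.topologicalClosure (R := ℂ) (A := RepOf.Product R)
    (NonUnitalStarAlgebra.adjoin ℂ (Set.range (RepOf.directSum R))))

noncomputable instance (R : RepClass S) : NonUnitalCStarAlgebra (UniversalCStarAlgebra R) :=
  NonUnitalStarSubalgebra.nonUnitalCStarAlgebra
    (NonUnitalStarSubalgebra.topologicalClosure (R := ℂ) (A := RepOf.Product R)
      (NonUnitalStarAlgebra.adjoin ℂ (Set.range (RepOf.directSum R))))
    (h_closed := NonUnitalStarSubalgebra.isClosed_topologicalClosure _)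

/-- The canonical map of `S` into the universal C*-algebra of `R`. -/
noncomputable def UniversalCStarAlgebra.of (R : RepClass S) (s : S) : UniversalCStarAlgebra R :=
  ⟨RepOf.directSum R s, NonUnitalStarSubalgebra.le_topologicalClosure _
    (NonUnitalStarAlgebra.subset_adjoin ℂ _ ⟨s, rfl⟩)⟩

end Universal

/-! ### Tight and cover-to-join representations of a semilattice. -/

section Semilattice

variable {E : Type*} [SemilatticeInf E] [OrderBot E]

/-! The two classes differ only by degeneracy. Tight implies cover-to-join (`X = {x}`, `Y = ∅`).
Conversely, cover-to-join gives every instance of tightness with `X` nonempty, since the meet of `X`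
is then an element of `E`. For `X = ∅` one needs in addition that finite covers of `E` have join
`1`. The zero representation on a nonzero space violates this as soon as `E` has a finite cover, but
every nondegenerate cover-to-join representation satisfies it.

A cover-to-join `π` is the direct sum of its restriction to the essential subspace, which is tight,
and a zero representation, which detects nothing. Hence an algebra universal for the cover-to-join
class is also universal for the tight class
(`IsUniversalCStarAlgebra.tightReps_of_coverToJoinReps`). Algebras universal for one class are
isomorphic over `S`, because each embeds in the product of all `B(H)` with the same image
(`range_toProduct`). Existence comes from this image itself. -/

theorem SemilatticeRep.mono {B : Type*} [GeneralizedBooleanAlgebra B] (π : SemilatticeRep E B)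
    {x y : E} (h : x ≤ y) : π.toFun x ≤ π.toFun y := by
  rw [← inf_eq_left.2 h, π.map_inf]
  exact inf_le_right

theorem SemilatticeRep.map_finset_inf_le {B : Type*} [BooleanAlgebra B] (π : SemilatticeRep E B)
    {x : E} {X : Finset E} (h : ∀ y ∈ X, x ≤ y) : π.toFun x ≤ X.inf π.toFun :=
  Finset.le_inf fun y hy => π.mono (h y hy)

/-- The elements `z ⊓ x`, `z ∈ Z`, cover the elements below `x` if `Z` covers `E`. -/
theorem IsCover.image_inf [DecidableEq E] {Z : Finset E}
    (hZ : IsCover (Z : Set E) Set.univ) (x : E) :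
    IsCover ((Z.image (· ⊓ x) : Finset E) : Set E) (meetSet {x} ∅) := by
  refine ⟨fun w hw => ?_, fun w hw hw0 => ?_⟩
  · obtain ⟨z, -, rfl⟩ := Finset.mem_image.1 (Finset.mem_coe.1 hw)
    exact ⟨by simp, by simp⟩
  · obtain ⟨z, hz, hzw⟩ := hZ.2 w trivial hw0
    refine ⟨z ⊓ x, Finset.mem_coe.2 (Finset.mem_image_of_mem _ (Finset.mem_coe.1 hz)), ?_⟩
    rwa [inf_assoc, inf_eq_right.2 (hw.1 x (by simp))]

theorem SemilatticeRep.IsTight.isCoverToJoin {B : Type*} [BooleanAlgebra B]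
    {π : SemilatticeRep E B} (h : π.IsTight) : π.IsCoverToJoin := fun x Z hZ => by
  simpa using h {x} ∅ Z hZ

/-- By monotonicity the join never exceeds `π x`, so only one inequality matters. Written with `⊓`,
it becomes an equation between products of projections. -/
theorem SemilatticeRep.isCoverToJoin_iff_inf_sup_eq {B : Type*} [GeneralizedBooleanAlgebra B]
    (π : SemilatticeRep E B) :
    π.IsCoverToJoin ↔ ∀ (x : E) (Z : Finset E), IsCover (Z : Set E) (meetSet {x} ∅) →
      π.toFun x ⊓ Z.sup π.toFun = π.toFun x := by
  refine forall₃_congr fun x Z hZ => ?_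
  have h : Z.sup π.toFun ≤ π.toFun x :=
    Finset.sup_le fun z hz => π.mono ((hZ.1 (Finset.mem_coe.2 hz)).1 x (by simp))
  rw [inf_eq_left, h.ge_iff_eq]

/-- A cover-to-join representation under which the join over every finite cover of `E` is `⊤` is
tight. -/
theorem SemilatticeRep.IsCoverToJoin.isTight {B : Type*} [BooleanAlgebra B]
    {π : SemilatticeRep E B} (h : π.IsCoverToJoin)
    (htop : ∀ Z : Finset E, IsCover (Z : Set E) Set.univ → Z.sup π.toFun = ⊤) : π.IsTight := by
  classical
  intro X Y Z hZ
  apply le_antisymm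
  · refine Finset.sup_le fun z hz => le_inf ?_ (Finset.le_inf fun y hy => ?_)
    · exact π.map_finset_inf_le (hZ.1 (Finset.mem_coe.2 hz)).1
    · rw [le_compl_iff_disjoint_right, disjoint_iff, ← π.map_inf,
        (hZ.1 (Finset.mem_coe.2 hz)).2 y hy, π.map_bot]
  -- Moving the complements of `Y` to the other side turns tightness into a statement about `Z` and
  -- `Y` together: an element orthogonal to `Y` meets `Z`, any other one meets `Y`.
  · have key : X.inf π.toFun ≤ Z.sup π.toFun ⊔ Y.sup π.toFun := by
      rcases X.eq_empty_or_nonempty with rfl | hX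
      -- The empty meet `⊤` need not be the image of an element of `E`; only here is `htop` used,
      -- for the cover `Z ∪ Y` of `E`.
      · rw [← Finset.sup_union, htop]
        · exact le_top
        · refine ⟨Set.subset_univ _, fun x _ hx => ?_⟩
          by_cases hxY : ∃ y ∈ Y, x ⊓ y ≠ ⊥
          · obtain ⟨y, hy, hxy⟩ := hxY
            exact ⟨y, by simp [hy], by rwa [inf_comm]⟩
          · push Not at hxY
            obtain ⟨z, hz, hzx⟩ := hZ.2 x ⟨by simp, hxY⟩ hx
            exact ⟨z, by simp [Finset.mem_coe.1 hz], hzx⟩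
      · set x := X.inf' hX id with hxdef
        have hle : ∀ w, w ≤ x ↔ ∀ a ∈ X, w ≤ a := fun w => by simp [hxdef]
        have hπ : ∀ (X : Finset E) (hX : X.Nonempty),
            X.inf π.toFun = π.toFun (X.inf' hX id) := by
          intro X hX
          induction hX using Finset.Nonempty.cons_induction with
          | singleton a => simp
          | cons a s ha hs ih => rw [Finset.inf_cons, ih, Finset.inf'_cons hs, π.map_inf]; rfl
        -- The elements of `Y` are cut down by `x` because a cover must consist of elements below
        -- `x`.
        have hcov : IsCover ((Z ∪ Y.image (· ⊓ x) : Finset E) : Set E) (meetSet {x} ∅) := by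
          refine ⟨fun w hw => ⟨fun a ha => ?_, by simp⟩, fun w hw hw0 => ?_⟩
          · obtain rfl := Finset.mem_singleton.1 ha
            rcases Finset.mem_union.1 (Finset.mem_coe.1 hw) with hw | hw
            · exact (hle w).2 (hZ.1 (Finset.mem_coe.2 hw)).1
            · obtain ⟨y, -, rfl⟩ := Finset.mem_image.1 hw
              exact inf_le_right
          · have hwx : w ≤ x := hw.1 x (by simp)
            by_cases hwY : ∃ y ∈ Y, w ⊓ y ≠ ⊥
            · obtain ⟨y, hy, hwy⟩ := hwY
              refine ⟨y ⊓ x, Finset.mem_coe.2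
                (Finset.mem_union_right _ (Finset.mem_image_of_mem _ hy)), ?_⟩
              rwa [inf_assoc, inf_eq_right.2 hwx, inf_comm]
            · push Not at hwY
              obtain ⟨z, hz, hzw⟩ := hZ.2 w ⟨(hle w).1 hwx, hwY⟩ hw0
              exact ⟨z, Finset.mem_coe.2 (Finset.mem_union_left _ (Finset.mem_coe.1 hz)), hzw⟩
        rw [hπ X hX, ← h x _ hcov, Finset.sup_union, Finset.sup_image]
        exact sup_le_sup_left (Finset.sup_mono_fun fun y _ => π.mono inf_le_left) _
    have hcompl : Y.inf (fun y => (π.toFun y)ᶜ) = (Y.sup π.toFun)ᶜ := (Finset.compl_sup Y _).symm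
    rw [hcompl, ← sdiff_eq, sdiff_le_iff, sup_comm]
    exact key

end Semilattice

/-! ### Kernel criteria and nondegenerate representations. -/

namespace HilbertRep

variable {S : Type*} [InverseSemigroupWithZero S]
  {H : Type*} [NormedAddCommGroup H] [InnerProductSpace ℂ H] [CompleteSpace H]

/-- A vector is annihilated by a finite join iff it is annihilated by its members. -/
theorem sup_restrict_apply_eq_zero_iff (π : HilbertRep S H)
    (Z : Finset (IdempotentSemilattice S)) (v : H) :
    (Z.sup π.restrict.toFun).1.1 v = 0 ↔ ∀ z ∈ Z, π.toFun z.1 v = 0 := by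
  classical
  induction Z using Finset.induction_on with
  | empty =>
    refine iff_of_true ?_ (by simp)
    rw [Finset.sup_empty]
    rfl
  | insert e Z he ih =>
    rw [Finset.sup_insert, Finset.forall_mem_insert, ← ih]
    generalize Z.sup π.restrict.toFun = q
    have hpp : π.toFun e.1 * π.toFun e.1 = π.toFun e.1 := by rw [← π.map_mul, e.2]
    have hcomm : π.toFun e.1 * q.1.1 = q.1.1 * π.toFun e.1 :=
      congrArg Subtype.val (mul_comm (π.restrict.toFun e).1 q.1)
    have hsup : (π.restrict.toFun e ⊔ q).1.1
        = π.toFun e.1 + q.1.1 - π.toFun e.1 * q.1.1 := rfl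
    rw [hsup]
    constructor
    · intro h
      have h1 : π.toFun e.1 v = 0 := by
        -- For commuting projections `p * (p + q - p * q) = p`, so a vector killed by the join is
        -- killed by `p`.
        have := congrArg (π.toFun e.1) h
        rw [_root_.map_zero, ← mul_apply_eq_comp, mul_sub, mul_add, ← mul_assoc, hpp,
          add_sub_cancel_right] at this
        exact this
      refine ⟨h1, ?_⟩
      rw [hcomm] at h
      simpa [h1] using h
    · rintro ⟨h1, h2⟩
      simp [h1, h2]

/-- For projections, `p ⊓ q = p` iff the kernel of `q` is contained in that of `p`. -/
theorem Projections.inf_eq_left_iff (π : HilbertRep S H) (p q : π.Projections) :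
    p ⊓ q = p ↔ ∀ v, q.1.1 v = 0 → p.1.1 v = 0 := by
  have hle : p ⊓ q = p ↔ p.1.1 * q.1.1 = p.1.1 :=
    ⟨fun h => congrArg (fun r : π.Projections => r.1.1) h,
      fun h => Subtype.ext (Subtype.ext h)⟩
  have hqq : q.1.1 * q.1.1 = q.1.1 := congrArg Subtype.val q.2
  rw [hle]
  constructor
  · intro h v hv
    rw [← h, mul_apply_eq_comp, hv, _root_.map_zero]
  · intro h
    ext v
    have h0 : q.1.1 (v - q.1.1 v) = 0 := by
      rw [map_sub, ← mul_apply_eq_comp, hqq, sub_self]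
    have := h _ h0
    rw [map_sub, sub_eq_zero] at this
    exact this.symm

/-- This form speaks only of vectors, not of the Boolean algebra attached to `π`, so it passes at
once to invariant subspaces. -/
theorem isCoverToJoin_iff (π : HilbertRep S H) :
    π.IsCoverToJoin ↔ ∀ (x : IdempotentSemilattice S) (Z : Finset (IdempotentSemilattice S)),
      IsCover (Z : Set (IdempotentSemilattice S)) (meetSet {x} ∅) →
        ∀ v, (∀ z ∈ Z, π.toFun z.1 v = 0) → π.toFun x.1 v = 0 := by
  refine π.restrict.isCoverToJoin_iff_inf_sup_eq.trans (forall₃_congr fun x Z hZ => ?_)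
  rw [Projections.inf_eq_left_iff]
  simp_rw [sup_restrict_apply_eq_zero_iff]
  rfl

theorem sup_restrict_eq_top_iff (π : HilbertRep S H) (Z : Finset (IdempotentSemilattice S)) :
    Z.sup π.restrict.toFun = ⊤ ↔ ∀ v, (∀ z ∈ Z, π.toFun z.1 v = 0) → v = 0 := by
  have h : Z.sup π.restrict.toFun = ⊤ ↔ ⊤ ⊓ Z.sup π.restrict.toFun = ⊤ := by rw [top_inf_eq]
  rw [h, Projections.inf_eq_left_iff]
  simp_rw [sup_restrict_apply_eq_zero_iff]
  rfl

theorem IsTight.isCoverToJoin {π : HilbertRep S H} (h : π.IsTight) : π.IsCoverToJoin :=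
  SemilatticeRep.IsTight.isCoverToJoin h

/-- A nondegenerate cover-to-join representation is tight. -/
theorem IsCoverToJoin.isTight {π : HilbertRep S H} (h : π.IsCoverToJoin)
    (hnd : ∀ v, (∀ s, π.toFun s v = 0) → v = 0) : π.IsTight := by
  classical
  refine SemilatticeRep.IsCoverToJoin.isTight h fun Z hZ => ?_
  rw [sup_restrict_eq_top_iff]
  intro v hv
  -- The cover `Z` of `E`, cut down by `e`, covers `e`; as `π (z * e) = π e * π z` kills `v`, so
  -- does `π e`. Then `s = s * (star s * s)` carries this to all of `S`.
  have hE : ∀ e : IdempotentSemilattice S, π.toFun e.1 v = 0 := fun e => by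
    refine π.isCoverToJoin_iff.1 h e _ (hZ.image_inf e) v fun w hw => ?_
    obtain ⟨z, hz, rfl⟩ := Finset.mem_image.1 hw
    change π.toFun (z.1 * e.1) v = 0
    rw [idem_comm z.2 e.2, π.map_mul, mul_apply_eq_comp, hv z hz, _root_.map_zero]
  refine hnd v fun s => ?_
  have hs : star s * s * (star s * s) = star s * s := by rw [← mul_assoc, star_mul_self_mul_star]
  have : π.toFun s = π.toFun s * π.toFun (star s * s) := by
    rw [← π.map_mul, ← mul_assoc, mul_star_mul_self]
  rw [this, mul_apply_eq_comp, hE ⟨_, hs⟩, _root_.map_zero]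

/-- The vectors annihilated by a representation. -/
def nullSpace (π : HilbertRep S H) : Submodule ℂ H :=
  ⨅ s, (π.toFun s).ker

theorem mem_nullSpace {π : HilbertRep S H} {v : H} :
    v ∈ π.nullSpace ↔ ∀ s, π.toFun s v = 0 := by
  simp [nullSpace]

/-- Moving `π s` across the inner product gives `π (star s)`, which also kills the null space. Thus
the orthogonal complement is invariant. -/
theorem apply_mem_nullSpace_orthogonal (π : HilbertRep S H) (s : S) (v : H) :
    π.toFun s v ∈ π.nullSpaceᗮ := by
  intro n hn
  rw [← ContinuousLinearMap.adjoint_inner_left, ← ContinuousLinearMap.star_eq_adjoint,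
    ← π.map_star, mem_nullSpace.1 hn, inner_zero_left]

end HilbertRep

/-! ### The essential part of a representation. -/

/-- Conjugation of operators by the inclusion of a closed subspace: extension by zero on the
orthogonal complement. -/
noncomputable def Submodule.extendOperator {H : Type*} [NormedAddCommGroup H]
    [InnerProductSpace ℂ H] [CompleteSpace H] (K : Submodule ℂ H) [CompleteSpace K] :
    (K →L[ℂ] K) →⋆ₙₐ[ℂ] (H →L[ℂ] H) where
  toFun T := K.subtypeL ∘L T ∘L K.orthogonalProjectionOnto
  map_smul' c T := by ext; simp
  map_zero' := by ext; simp
  map_add' T T' := by ext; simp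
  map_mul' T T' := by ext; simp
  map_star' T := by
    simp only [ContinuousLinearMap.star_eq_adjoint, ContinuousLinearMap.adjoint_comp,
      Submodule.adjoint_subtypeL, Submodule.adjoint_orthogonalProjectionOnto]
    rfl

theorem Submodule.extendOperator_apply {H : Type*} [NormedAddCommGroup H]
    [InnerProductSpace ℂ H] [CompleteSpace H] (K : Submodule ℂ H) [CompleteSpace K]
    (T : K →L[ℂ] K) (v : H) :
    K.extendOperator T v = T (K.orthogonalProjectionOnto v) :=
  rfl

namespace HilbertRep

variable {S : Type*} [InverseSemigroupWithZero S]
  {H : Type*} [NormedAddCommGroup H] [InnerProductSpace ℂ H] [CompleteSpace H]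

/-- The restriction of a representation to its essential subspace. -/
noncomputable def essential (π : HilbertRep S H) : HilbertRep S π.nullSpaceᗮ where
  toFun s := (π.toFun s ∘L π.nullSpaceᗮ.subtypeL).codRestrict π.nullSpaceᗮ
    fun v => π.apply_mem_nullSpace_orthogonal s v
  map_mul s t := by
    ext v
    simp only [π.map_mul]
    rfl
  map_star s := by
    rw [ContinuousLinearMap.star_eq_adjoint, ContinuousLinearMap.eq_adjoint_iff]
    intro v w
    change inner ℂ (π.toFun (star s) v) (w : H) = inner ℂ (v : H) (π.toFun s w)
    rw [π.map_star, ContinuousLinearMap.star_eq_adjoint, ContinuousLinearMap.adjoint_inner_left]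
  map_zero := by ext v; simp [π.map_zero]

theorem coe_essential_apply (π : HilbertRep S H) (s : S) (v : π.nullSpaceᗮ) :
    (π.essential.toFun s v : H) = π.toFun s v :=
  rfl

/-- The difference between `v` and its projection lies in the double orthogonal complement of the
null space, which is the null space itself because that is closed; so `π s` does not see it. -/
theorem extendOperator_essential (π : HilbertRep S H) (s : S) :
    π.nullSpaceᗮ.extendOperator (π.essential.toFun s) = π.toFun s := by
  ext v
  rw [Submodule.extendOperator_apply, coe_essential_apply, ← sub_eq_zero, ← map_sub]
  have hclosed : IsClosed (π.nullSpace : Set H) := by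
    have : (π.nullSpace : Set H) = ⋂ s, {v | π.toFun s v = 0} := by
      ext v; simp [mem_nullSpace]
    rw [this]
    exact isClosed_iInter fun s => isClosed_eq (π.toFun s).continuous continuous_const
  have : CompleteSpace π.nullSpace := hclosed.completeSpace_coe
  have hmem := π.nullSpaceᗮ.sub_starProjection_mem_orthogonal v
  rw [Submodule.orthogonal_orthogonal, ← neg_mem_iff, neg_sub] at hmem
  exact mem_nullSpace.1 hmem s

theorem IsCoverToJoin.isTight_essential {π : HilbertRep S H} (h : π.IsCoverToJoin) :
    π.essential.IsTight := by
  refine IsCoverToJoin.isTight ?_ ?_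
  · rw [isCoverToJoin_iff] at h ⊢
    intro x Z hZ v hv
    exact Subtype.ext (h x Z hZ v fun z hz => congrArg Subtype.val (hv z hz))
  · intro v hv
    have hN : (v : H) ∈ π.nullSpace := mem_nullSpace.2 fun s => congrArg Subtype.val (hv s)
    exact Subtype.ext (inner_self_eq_zero.1 (v.2 _ hN))

end HilbertRep

open scoped CStarAlgebra in
/-- *-homomorphisms which agree on a set generating a C*-algebra are equal. -/
theorem NonUnitalStarAlgHom.ext_of_topologicalClosure_adjoin_eq_top {A B : Type*}
    [NonUnitalCStarAlgebra A] [NonUnitalCStarAlgebra B] {s : Set A}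
    (hs : (NonUnitalStarAlgebra.adjoin ℂ s).topologicalClosure = ⊤) {φ ψ : A →⋆ₙₐ[ℂ] B}
    (h : s.EqOn φ ψ) : φ = ψ := by
  have hφ : Continuous φ := map_continuous φ
  have hψ : Continuous ψ := map_continuous ψ
  have hle : (NonUnitalStarAlgebra.adjoin ℂ s).topologicalClosure ≤
      NonUnitalStarAlgHom.equalizer φ ψ :=
    NonUnitalStarSubalgebra.topologicalClosure_minimal _
      (NonUnitalStarAlgebra.adjoin_le h) (isClosed_eq hφ hψ)
  ext a
  exact hle (hs ▸ trivial : a ∈ (NonUnitalStarAlgebra.adjoin ℂ s).topologicalClosure)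

/-! ### Existence and uniqueness of universal C*-algebras. -/

section Universal

variable {S : Type u} [InverseSemigroupWithZero S]

/-- The projection of the product onto the operators on the space of one representation. -/
noncomputable def RepOf.Product.eval {R : RepClass S} (r : RepOf R) :
    RepOf.Product R →⋆ₙₐ[ℂ] (r.space →L[ℂ] r.space) where
  toFun a := a.1 r
  map_smul' _ _ := rfl
  map_zero' := rfl
  map_add' _ _ := rfl
  map_mul' _ _ := rfl
  map_star' _ := rfl

/-- The inclusion of the universal C*-algebra into the product. -/
noncomputable def UniversalCStarAlgebra.incl (R : RepClass S) :
    UniversalCStarAlgebra R →⋆ₙₐ[ℂ] RepOf.Product R where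
  toFun a := a.1
  map_smul' _ _ := rfl
  map_zero' := rfl
  map_add' _ _ := rfl
  map_mul' _ _ := rfl
  map_star' _ := rfl

theorem UniversalCStarAlgebra.isUniversal (R : RepClass S) :
    IsUniversalCStarAlgebra R (UniversalCStarAlgebra R) (UniversalCStarAlgebra.of R) := by
  have hgen : (NonUnitalStarAlgebra.adjoin ℂ
      (Set.range (UniversalCStarAlgebra.of R))).topologicalClosure = ⊤ := by
    refine eq_top_iff.2 fun a _ => ?_
    have hmap : (NonUnitalStarAlgebra.adjoin ℂ (Set.range (UniversalCStarAlgebra.of R))).map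
        (UniversalCStarAlgebra.incl R) =
        NonUnitalStarAlgebra.adjoin ℂ (Set.range (RepOf.directSum R)) := by
      rw [NonUnitalStarAlgHom.map_adjoin, ← Set.range_comp]
      rfl
    -- Density in the closed subalgebra is tested in the ambient product, where the generated
    -- *-algebras correspond by `hmap`.
    refine closure_subtype.2 ?_
    have himg := congrArg (fun M : NonUnitalStarSubalgebra ℂ (RepOf.Product R) =>
      closure (M : Set (RepOf.Product R))) hmap
    exact himg.ge a.2
  refine ⟨hgen, fun H _ _ _ π hπ => ?_, fun a ha => ?_⟩
  · let r : RepOf R := ⟨H, π, hπ⟩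
    refine ⟨(RepOf.Product.eval r).comp (UniversalCStarAlgebra.incl R), fun s => rfl,
      fun ψ hψ => ?_⟩
    refine NonUnitalStarAlgHom.ext_of_topologicalClosure_adjoin_eq_top hgen ?_
    rintro _ ⟨s, rfl⟩
    exact hψ s
  · by_contra! hcon
    refine ha (Subtype.ext (Subtype.ext (funext fun r => ?_)))
    exact hcon r.space r.normed r.inner r.complete r.rep
      ((RepOf.Product.eval r).comp (UniversalCStarAlgebra.incl R)) r.mem fun s => rfl

namespace IsUniversalCStarAlgebra

variable {R : RepClass S} {A : Type*} [NonUnitalCStarAlgebra A] {ι : S → A}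

/-- The *-homomorphism induced by a representation. -/
noncomputable def lift (h : IsUniversalCStarAlgebra R A ι) (r : RepOf R) :
    A →⋆ₙₐ[ℂ] (r.space →L[ℂ] r.space) :=
  (h.existsUnique_hom r.space r.rep r.mem).choose

theorem lift_apply (h : IsUniversalCStarAlgebra R A ι) (r : RepOf R) (s : S) :
    h.lift r (ι s) = r.rep.toFun s :=
  (h.existsUnique_hom r.space r.rep r.mem).choose_spec.1 s

/-- The product of the *-homomorphisms induced by all representations in the class. -/
noncomputable def toProduct (h : IsUniversalCStarAlgebra R A ι) : A →⋆ₙₐ[ℂ] RepOf.Product R where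
  toFun a := ⟨fun r => h.lift r a, memℓp_infty_iff.2
    ⟨‖a‖, by rintro _ ⟨r, rfl⟩; exact NonUnitalStarAlgHom.norm_apply_le (h.lift r) a⟩⟩
  map_smul' c a := Subtype.ext (funext fun r => map_smul (h.lift r) c a)
  map_zero' := Subtype.ext (funext fun r => map_zero (h.lift r))
  map_add' a b := Subtype.ext (funext fun r => map_add (h.lift r) a b)
  map_mul' a b := Subtype.ext (funext fun r => map_mul (h.lift r) a b)
  map_star' a := Subtype.ext (funext fun r => map_star (h.lift r) a)

theorem toProduct_apply (h : IsUniversalCStarAlgebra R A ι) (s : S) :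
    h.toProduct (ι s) = RepOf.directSum R s :=
  Subtype.ext (funext fun r => h.lift_apply r s)

/-- A homomorphism that detects `a` is, by uniqueness, one of the coordinates of `toProduct`. -/
theorem toProduct_injective (h : IsUniversalCStarAlgebra R A ι) :
    Function.Injective h.toProduct := by
  rw [injective_iff_map_eq_zero]
  intro a ha
  by_contra ha0
  obtain ⟨H, _, _, _, π, φ, hπ, hφ, hφa⟩ := h.separates a ha0
  have : φ = h.lift ⟨H, π, hπ⟩ :=
    (h.existsUnique_hom H π hπ).unique hφ fun s => h.lift_apply ⟨H, π, hπ⟩ s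
  rw [this] at hφa
  exact hφa (congrArg (RepOf.Product.eval ⟨H, π, hπ⟩) ha)

/-- An injective *-homomorphism of C*-algebras is isometric, so it maps closures onto closures. The
right-hand side does not depend on `A`, which makes universal algebras comparable. -/
theorem range_toProduct (h : IsUniversalCStarAlgebra R A ι) :
    Set.range h.toProduct = closure
      ((NonUnitalStarAlgebra.adjoin ℂ (Set.range (RepOf.directSum R))) :
        Set (RepOf.Product R)) := by
  have hmap : (NonUnitalStarAlgebra.adjoin ℂ (Set.range ι)).map h.toProduct =
      NonUnitalStarAlgebra.adjoin ℂ (Set.range (RepOf.directSum R)) := by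
    rw [NonUnitalStarAlgHom.map_adjoin, ← Set.range_comp]
    congr 2
    exact funext h.toProduct_apply
  have hiso : Isometry h.toProduct := NonUnitalStarAlgHom.isometry _ h.toProduct_injective
  have himg : h.toProduct '' closure (NonUnitalStarAlgebra.adjoin ℂ (Set.range ι) : Set A) =
      closure (h.toProduct '' (NonUnitalStarAlgebra.adjoin ℂ (Set.range ι) : Set A)) :=
    (hiso.isClosedEmbedding.isClosedMap.closure_image_eq_of_continuous hiso.continuous _).symm
  have htop : closure (NonUnitalStarAlgebra.adjoin ℂ (Set.range ι) : Set A) = Set.univ :=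
    congrArg (fun M : NonUnitalStarSubalgebra ℂ A => (M : Set A)) h.generates
  rw [htop, Set.image_univ] at himg
  rw [himg, ← hmap]
  rfl

/-- Two universal C*-algebras for the same class are isomorphic over `S`. -/
theorem exists_starAlgEquiv {B : Type*} [NonUnitalCStarAlgebra B] {κ : S → B}
    (hA : IsUniversalCStarAlgebra R A ι) (hB : IsUniversalCStarAlgebra R B κ) :
    ∃ Φ : A ≃⋆ₐ[ℂ] B, ∀ s, Φ (ι s) = κ s := by
  have hex : ∀ a, ∃ b, hB.toProduct b = hA.toProduct a := fun a => by
    rw [← Set.mem_range, hB.range_toProduct, ← hA.range_toProduct]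
    exact ⟨a, rfl⟩
  -- `f` is `hA.toProduct` followed by the inverse of `hB.toProduct` on the common range; its
  -- algebraic identities are checked after applying the injective `hB.toProduct`.
  choose f hf using hex
  have hinj := hB.toProduct_injective
  let φ : A →⋆ₙₐ[ℂ] B :=
    { toFun := f
      map_smul' := fun c a => hinj (by simp [hf])
      map_zero' := hinj (by simp [hf])
      map_add' := fun a b => hinj (by simp [hf])
      map_mul' := fun a b => hinj (by simp [hf])
      map_star' := fun a => hinj (by simp [hf, map_star]) }
  have hbij : Function.Bijective φ := by
    refine ⟨fun a b hab => hA.toProduct_injective ?_, fun b => ?_⟩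
    · rw [← hf a, ← hf b]
      exact congrArg hB.toProduct hab
    · have hb : hB.toProduct b ∈ Set.range hA.toProduct := by
        rw [hA.range_toProduct, ← hB.range_toProduct]
        exact ⟨b, rfl⟩
      obtain ⟨a, ha⟩ := hb
      exact ⟨a, hinj ((hf a).trans ha)⟩
  refine ⟨StarAlgEquiv.ofBijective φ hbij, fun s => hinj ?_⟩
  rw [StarAlgEquiv.ofBijective_apply]
  exact (hf (ι s)).trans ((hA.toProduct_apply s).trans (hB.toProduct_apply s).symm)

end IsUniversalCStarAlgebra

end Universal

/-! ### Comparison of the two classes. -/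

/-- A C*-algebra universal for the cover-to-join representations is universal for the tight
ones. -/
theorem IsUniversalCStarAlgebra.tightReps_of_coverToJoinReps {S : Type u}
    [InverseSemigroupWithZero S] {A : Type*} [NonUnitalCStarAlgebra A] {ι : S → A}
    (h : IsUniversalCStarAlgebra (coverToJoinReps S) A ι) :
    IsUniversalCStarAlgebra (tightReps S) A ι := by
  refine ⟨h.generates, fun H _ _ _ π hπ => h.existsUnique_hom H π hπ.isCoverToJoin,
    fun a ha => ?_⟩
  obtain ⟨H, _, _, _, π, φ, hπ, hφ, hφa⟩ := h.separates a ha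
  have hess : π.essential.IsTight := HilbertRep.IsCoverToJoin.isTight_essential hπ
  obtain ⟨ψ, hψ, -⟩ := h.existsUnique_hom _ π.essential hess.isCoverToJoin
  refine ⟨_, inferInstance, inferInstance, inferInstance, π.essential, ψ, hess, hψ,
    fun hψa => hφa ?_⟩
  -- Both sides induce `π`, so they agree by uniqueness; hence `ψ` cannot vanish at `a` if `φ` does
  -- not.
  have : φ = π.nullSpaceᗮ.extendOperator.comp ψ :=
    (h.existsUnique_hom H π hπ).unique hφ fun s => by
      rw [NonUnitalStarAlgHom.comp_apply, hψ, π.extendOperator_essential]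
  rw [this, NonUnitalStarAlgHom.comp_apply, hψa, map_zero]

theorem theorem6p1 (S : Type u) [InverseSemigroupWithZero S] :
    IsUniversalCStarAlgebra (tightReps S)
        (UniversalCStarAlgebra (tightReps S)) (UniversalCStarAlgebra.of (tightReps S)) ∧
    IsUniversalCStarAlgebra (coverToJoinReps S)
        (UniversalCStarAlgebra (coverToJoinReps S))
        (UniversalCStarAlgebra.of (coverToJoinReps S)) ∧
    ∀ (A : Type*) (B : Type*) [NonUnitalCStarAlgebra A] [NonUnitalCStarAlgebra B]
      (ιA : S → A) (ιB : S → B),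
      IsUniversalCStarAlgebra (tightReps S) A ιA →
      IsUniversalCStarAlgebra (coverToJoinReps S) B ιB →
      ∃ Φ : A ≃⋆ₐ[ℂ] B, ∀ s : S, Φ (ιA s) = ιB s := by

  exact ⟨UniversalCStarAlgebra.isUniversal _, UniversalCStarAlgebra.isUniversal _,
    fun A B _ _ ιA ιB hA hB => hA.exists_starAlgEquiv hB.tightReps_of_coverToJoinReps⟩
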